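/- Let $d\ge 1$ and let $\mu(z)=(1+e^{-z})^{-1}$ be the sigmoid function, with derivative $\dot\mu$, and let $L=1/4$. Let $\Theta\subset\mathbb R^d$ be compact, $S=\max_{\theta\in\Theta}\|\theta\|_2$, and let $\theta_*\in\Theta$ be fixed. Consider a stochastic contextual bandit: at each round $t\ge 1$ the agent is presented a (possibly random) action set $\mathcal X_t\subset\{x\in\mathbb R^d:\|x\|_2\le 1\}$, selects a (random) action $x_t\in\mathcal X_t$, and receives a reward $r_{t+1}\in\{0,1\}$ such that $$\mathbb P(r_{t+1}=1\mid x_t,\mathcal F_t)=\mu(x_t^{\top}\theta_*)\quad\text{almost surely},$$ where $\mathcal F_t$ is the $\sigma$-algebra generated by $\mathcal F_0$ and $x_1,r_2,\dots,x_{t-1},r_t$, and $\mathcal F_0$ is an arbitrary $\sigma$-algebra of events (prior knowledge). Fix $\lambda>0$. For $t\ge1$ and $\theta\in\mathbb R^d$ let $$\mathcal L_t^\lambda(\theta)=\sum_{s=1}^{t-1}\big[r_{s+1}\log\mu(x_s^{\top}\theta)+(1-r_{s+1})\log(1-\mu(x_s^{\top}\theta))\big]-\frac\lambda2\|\theta\|_2^2,\qquad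 \hat\theta_t=\arg\max_{\theta\in\mathbb R^d}\mathcal L_t^\lambda(\theta),$$ $$g_t(\theta)=\sum_{s=1}^{t-1}\mu(x_s^{\top}\theta)x_s+\lambda\theta,\qquad \mathbf H_t(\theta)=\sum_{s=1}^{t-1}\dot\mu(x_s^{\top}\theta)x_sx_s^{\top}+\lambda\mathbf I_d,$$ and write $\|v\|_{\mathbf M}=\sqrt{v^{\top}\mathbf M v}$. For $\delta\in(0,1]$ let $$\gamma_t(\delta)=\sqrt\lambda\Big(S+\frac12\Big)+\frac{2}{\sqrt\lambda}\log\!\left(\frac{2^d}{\delta}\Big(1+\frac{Lt}{d\lambda}\Big)^{d/2}\right),\qquad \mathcal C_t(\delta)=\Big\{\theta\in\Theta:\ \|g_t(\theta)-g_t(\hat\theta_t)\|_{\mathbf H_t^{-1}(\theta)}\le\gamma_t(\delta)\Big\}.$$ Then the event $E_\delta=\{\forall t\ge1,\ \theta_*\in\mathcal C_t(\delta)\}$ satisfies $\mathbb P(E_\delta)\ge 1-\delta$. -/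

import Mathlib

open MeasureTheory ProbabilityTheory

namespace LogisticBandit

noncomputable section

/-- The history available at the beginning of round `t`:
`ℱ_t = σ(ℱ_0, x_1, r_2, …, x_{t-1}, r_t)`, where `ℱ_0` is the prior knowledge. -/
@[reducible] def history {Ω : Type*} {d : ℕ} (F0 : MeasurableSpace Ω)
    (x : ℕ → Ω → EuclideanSpace ℝ (Fin d)) (r : ℕ → Ω → ℝ) (t : ℕ) : MeasurableSpace Ω :=
  F0 ⊔ ⨆ s ∈ Finset.Ico 1 t,
    (MeasurableSpace.comap (x s) inferInstance ⊔ MeasurableSpace.comap (r (s + 1)) inferInstance)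

/-- The information `σ(x_t, ℱ_t)` available when the reward of round `t` is drawn. -/
@[reducible] def historyWithAction {Ω : Type*} {d : ℕ} (F0 : MeasurableSpace Ω)
    (x : ℕ → Ω → EuclideanSpace ℝ (Fin d)) (r : ℕ → Ω → ℝ) (t : ℕ) : MeasurableSpace Ω :=
  MeasurableSpace.comap (x t) inferInstance ⊔ history F0 x r t

/-- The regularized log-likelihood of `θ` at round `t`, given the actions `x_1, x_2, …` and the
rewards `r_2, r_3, …` (only `x_s`, `r_{s+1}` with `1 ≤ s < t` are used). -/
def logLik {d : ℕ} (lam : ℝ) (x : ℕ → EuclideanSpace ℝ (Fin d)) (r : ℕ → ℝ) (t : ℕ)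
    (θ : EuclideanSpace ℝ (Fin d)) : ℝ :=
  (∑ s ∈ Finset.Ico 1 t,
    (r (s + 1) * Real.log (Real.sigmoid (inner ℝ (x s) θ))
      + (1 - r (s + 1)) * Real.log (1 - Real.sigmoid (inner ℝ (x s) θ))))
  - lam / 2 * ‖θ‖ ^ 2

/-- The regularized maximum likelihood estimator: a maximizer of the regularized log-likelihood
over the whole space (see `isMaxOn_mle`). -/
def mle {d : ℕ} (lam : ℝ) (x : ℕ → EuclideanSpace ℝ (Fin d)) (r : ℕ → ℝ) (t : ℕ) :
    EuclideanSpace ℝ (Fin d) :=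
  Classical.epsilon fun θ => IsMaxOn (logLik lam x r t) Set.univ θ

/-- The maximizer in the definition of `mle` exists as soon as `λ > 0` and the rewards lie
in `[0, 1]`. -/
theorem isMaxOn_mle {d : ℕ} {lam : ℝ} (hlam : 0 < lam) (x : ℕ → EuclideanSpace ℝ (Fin d))
    (r : ℕ → ℝ) (t : ℕ) (hr : ∀ s ∈ Finset.Ico 1 t, 0 ≤ r (s + 1) ∧ r (s + 1) ≤ 1) :
    IsMaxOn (logLik lam x r t) Set.univ (mle lam x r t) := by
  apply Classical.epsilon_spec (p := fun θ => IsMaxOn (logLik lam x r t) Set.univ θ)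
  have hcont : Continuous (logLik lam x r t) := by
    unfold logLik
    refine Continuous.sub (continuous_finsetSum _ fun s _ => ?_) (by fun_prop)
    have h : Continuous fun θ => Real.sigmoid (inner ℝ (x s) θ) :=
      continuous_sigmoid.comp (by fun_prop)
    refine (continuous_const.mul (h.log fun θ => (Real.sigmoid_pos _).ne')).add
      (continuous_const.mul ((continuous_const.sub h).log fun θ => ?_))
    exact (sub_pos.2 (Real.sigmoid_lt_one _)).ne'
  have hle : ∀ θ, logLik lam x r t θ ≤ -(lam / 2 * ‖θ‖ ^ 2) := by
    intro θ
    have : ∑ s ∈ Finset.Ico 1 t,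
        (r (s + 1) * Real.log (Real.sigmoid (inner ℝ (x s) θ))
          + (1 - r (s + 1)) * Real.log (1 - Real.sigmoid (inner ℝ (x s) θ))) ≤ 0 := by
      refine Finset.sum_nonpos fun s hs => ?_
      have hp := Real.sigmoid_pos (inner ℝ (x s) θ)
      have hp1 := Real.sigmoid_lt_one (inner ℝ (x s) θ)
      have h1 := Real.log_nonpos hp.le hp1.le
      have h2 := Real.log_nonpos (sub_nonneg.2 hp1.le) (by linarith)
      have h3 := mul_nonpos_of_nonneg_of_nonpos (hr s hs).1 h1
      have h4 := mul_nonpos_of_nonneg_of_nonpos (sub_nonneg.2 (hr s hs).2) h2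
      linarith
    unfold logLik
    linarith
  have htend : Filter.Tendsto (logLik lam x r t) (Filter.cocompact _) Filter.atBot := by
    refine Filter.tendsto_atBot_mono hle (Filter.tendsto_neg_atTop_atBot.comp ?_)
    exact Filter.Tendsto.const_mul_atTop (by positivity)
      ((Filter.tendsto_pow_atTop two_ne_zero).comp tendsto_norm_cocompact_atTop)
  obtain ⟨θ, hθ⟩ := hcont.exists_forall_ge htend
  exact ⟨θ, fun θ' _ => hθ θ'⟩

/-- `g_t(θ) = ∑_{s=1}^{t-1} μ(x_sᵀθ) x_s + λ θ`. -/
def g {d : ℕ} (lam : ℝ) (x : ℕ → EuclideanSpace ℝ (Fin d)) (t : ℕ)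
    (θ : EuclideanSpace ℝ (Fin d)) : EuclideanSpace ℝ (Fin d) :=
  (∑ s ∈ Finset.Ico 1 t, Real.sigmoid (inner ℝ (x s) θ) • x s) + lam • θ

/-- `H_t(θ) = ∑_{s=1}^{t-1} μ'(x_sᵀθ) x_s x_sᵀ + λ I_d`. -/
def H {d : ℕ} (lam : ℝ) (x : ℕ → EuclideanSpace ℝ (Fin d)) (t : ℕ)
    (θ : EuclideanSpace ℝ (Fin d)) : Matrix (Fin d) (Fin d) ℝ :=
  (∑ s ∈ Finset.Ico 1 t,
    deriv Real.sigmoid (inner ℝ (x s) θ) • Matrix.vecMulVec (x s).ofLp (x s).ofLp)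
  + lam • (1 : Matrix (Fin d) (Fin d) ℝ)

/-- The weighted norm `‖v‖_M = √(vᵀ M v)`. -/
def wnorm {d : ℕ} (M : Matrix (Fin d) (Fin d) ℝ) (v : EuclideanSpace ℝ (Fin d)) : ℝ :=
  Real.sqrt (v.ofLp ⬝ᵥ (M.mulVec v.ofLp))

/-- The upper bound `L = 1/4` on the derivative of the sigmoid. -/
def L : ℝ := 1 / 4

/-- The radius `γ_t(δ)`. -/
def gam (d : ℕ) (lam S δ : ℝ) (t : ℕ) : ℝ :=
  Real.sqrt lam * (S + 1 / 2)
  + 2 / Real.sqrt lam *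
      Real.log ((2 : ℝ) ^ d / δ * (1 + L * t / (d * lam)) ^ ((d : ℝ) / 2))

/-- The confidence set `C_t(δ)`, for given actions and rewards. -/
def confSet {d : ℕ} (Θ : Set (EuclideanSpace ℝ (Fin d))) (lam S δ : ℝ)
    (x : ℕ → EuclideanSpace ℝ (Fin d)) (r : ℕ → ℝ) (t : ℕ) : Set (EuclideanSpace ℝ (Fin d)) :=
  {θ | θ ∈ Θ ∧ wnorm (H lam x t θ)⁻¹ (g lam x t θ - g lam x t (mle lam x r t)) ≤ gam d lam S δ t}

/-- The event `E_δ = {∀ t ≥ 1, θ_* ∈ C_t(δ)}`. -/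
def goodEvent {Ω : Type*} {d : ℕ} (Θ : Set (EuclideanSpace ℝ (Fin d))) (lam S δ : ℝ)
    (x : ℕ → Ω → EuclideanSpace ℝ (Fin d)) (r : ℕ → Ω → ℝ)
    (θstar : EuclideanSpace ℝ (Fin d)) : Set Ω :=
  {ω | ∀ t : ℕ, 1 ≤ t → θstar ∈ confSet Θ lam S δ (fun s => x s ω) (fun s => r s ω) t}

end

end LogisticBandit

/-!
Write `S_t = ∑_{1 ≤ s < t} ε_{s+1} x_s` for the accumulated noise, `ε_{s+1} = r_{s+1} - μ(x_sᵀθ_*)`.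
The first-order condition for the estimator (`g_mle`) gives
`g_t(θ_*) - g_t(θ̂_t) = λ θ_* - S_t`. The first term has `H_t⁻¹`-norm at most `√λ S`, so everything
reduces to a bound on `‖S_t‖_{H_t⁻¹}` that holds for all `t` simultaneously.

This self-normalized bound comes from the method of mixtures. Given the past, `ε_{s+1}` is a centred
Bernoulli variable, whose moment generating function at `|η| ≤ 1` is at most `exp (μ' η²)`
(`bernoulli_mgf_le`). Hence for every `ξ` in the unit ball `exp (⟪ξ, S_t⟫ - ξᵀ (H_t - λ I) ξ)` is a
nonnegative supermartingale (`setLIntegral_tiltedLik_succ_le`), and so is its mixture over `ξ` against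
the Gaussian weight `exp (-λ ‖ξ‖²)` truncated to the unit ball. By Ville's inequality
(`measure_exists_mixture_gt_le`) the mixture never exceeds `1 / δ` times its initial value, outside an
event of probability at most `δ`.

Conversely, the mixture at time `t` is large when `‖S_t‖_{H_t⁻¹}` is: restricting the integral to the
ball of radius `1 / 2` around `ξ₀ = (√λ / 2) H_t⁻¹ S_t / ‖S_t‖_{H_t⁻¹}` bounds it below by
`exp ((√λ / 2) ‖S_t‖_{H_t⁻¹} - λ / 4) 2^{-d} λ^{d/2} (det H_t)^{-1/2}` times its initial value
(`le_setLIntegral_closedBall_exp_sub_sq`). Taking logarithms and bounding the determinant through the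
trace (`sqrt_det_H_le`) yields the radius `γ_t(δ)`.
-/

open scoped ENNReal

/-! ### Bernoulli moment generating function -/

/-- The moment generating function of a centred Bernoulli variable of parameter `p` is at most
`exp (Var · η²)` for `|η| ≤ 1`. The restriction on `η` is what allows the true variance `p (1 - p)`
in the exponent, and it forces the mixing measure below to live on the unit ball. -/
theorem bernoulli_mgf_le {p η : ℝ} (hp0 : 0 ≤ p) (hp1 : p ≤ 1) (hη : |η| ≤ 1) :
    p * Real.exp (η * (1 - p)) + (1 - p) * Real.exp (η * (0 - p))
      ≤ Real.exp (p * (1 - p) * η ^ 2) := by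
  have key : ∀ y : ℝ, |y| ≤ 1 → Real.exp y ≤ 1 + y + y ^ 2 := fun y hy => by
    have := (abs_le.1 (Real.abs_exp_sub_one_sub_id_le hy)).2
    linarith
  have h1 : |η * (1 - p)| ≤ 1 := by
    rw [abs_mul, abs_of_nonneg (sub_nonneg.2 hp1)]
    exact mul_le_one₀ hη (sub_nonneg.2 hp1) (by linarith)
  have h2 : |η * (0 - p)| ≤ 1 := by
    rw [zero_sub, mul_neg, abs_neg, abs_mul, abs_of_nonneg hp0]
    exact mul_le_one₀ hη hp0 hp1
  have h3 := mul_le_mul_of_nonneg_left (key _ h1) hp0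
  have h4 := mul_le_mul_of_nonneg_left (key _ h2) (sub_nonneg.2 hp1)
  have h5 := Real.add_one_le_exp (p * (1 - p) * η ^ 2)
  nlinarith

/-! ### Maximum likelihood -/

theorem hasDerivAt_log_sigmoid (z : ℝ) :
    HasDerivAt (fun z => Real.log (Real.sigmoid z)) (1 - Real.sigmoid z) z := by
  have := (Real.hasDerivAt_sigmoid z).log (Real.sigmoid_pos z).ne'
  rwa [mul_div_cancel_left₀ _ (Real.sigmoid_pos z).ne'] at this

theorem hasDerivAt_log_one_sub_sigmoid (z : ℝ) :
    HasDerivAt (fun z => Real.log (1 - Real.sigmoid z)) (-Real.sigmoid z) z := by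
  have h0 : 1 - Real.sigmoid z ≠ 0 := (sub_pos.2 (Real.sigmoid_lt_one z)).ne'
  have := ((Real.hasDerivAt_sigmoid z).const_sub 1).log h0
  rwa [neg_div, mul_div_cancel_right₀ _ h0] at this

/-- First-order optimality of the maximum likelihood estimator: `g_t` at the estimator is the
reward-weighted sum of the actions, hence free of the choice of a maximizer. -/
theorem g_mle {d : ℕ} {lam : ℝ} (hlam : 0 < lam) (x : ℕ → EuclideanSpace ℝ (Fin d))
    (r : ℕ → ℝ) (t : ℕ) (hr : ∀ s ∈ Finset.Ico 1 t, 0 ≤ r (s + 1) ∧ r (s + 1) ≤ 1) :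
    LogisticBandit.g lam x t (LogisticBandit.mle lam x r t)
      = ∑ s ∈ Finset.Ico 1 t, r (s + 1) • x s := by
  set θ := LogisticBandit.mle lam x r t with hθ
  have hmax := LogisticBandit.isMaxOn_mle hlam x r t hr
  rw [← hθ] at hmax
  refine ext_inner_right ℝ fun v => ?_
  have hlin : ∀ s, HasDerivAt (fun u : ℝ => inner ℝ (x s) (θ + u • v)) (inner ℝ (x s) v) 0 := by
    intro s
    have : (fun u : ℝ => inner ℝ (x s) (θ + u • v))
        = fun u : ℝ => inner ℝ (x s) θ + u * inner ℝ (x s) v := by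
      funext u; rw [inner_add_right, inner_smul_right]
    rw [this]
    simpa using ((hasDerivAt_id (0 : ℝ)).mul_const (inner ℝ (x s) v)).const_add (inner ℝ (x s) θ)
  have hnorm : HasDerivAt (fun u : ℝ => lam / 2 * ‖θ + u • v‖ ^ 2) (lam * inner ℝ θ v) 0 := by
    have : (fun u : ℝ => lam / 2 * ‖θ + u • v‖ ^ 2)
        = fun u : ℝ => lam / 2 * (‖θ‖ ^ 2 + u * (2 * inner ℝ θ v) + u ^ 2 * ‖v‖ ^ 2) := by
      funext u
      rw [norm_add_sq_real, norm_smul, inner_smul_right, mul_pow, Real.norm_eq_abs, sq_abs]; ring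
    rw [this]
    have h := ((((hasDerivAt_id (0 : ℝ)).mul_const (2 * inner ℝ θ v)).const_add (‖θ‖ ^ 2)).add
      ((hasDerivAt_pow 2 (0 : ℝ)).mul_const (‖v‖ ^ 2))).const_mul (lam / 2)
    refine h.congr_deriv ?_
    simp
    ring
  have hder : HasDerivAt (fun u : ℝ => LogisticBandit.logLik lam x r t (θ + u • v))
      ((∑ s ∈ Finset.Ico 1 t, (r (s + 1) - Real.sigmoid (inner ℝ (x s) θ)) * inner ℝ (x s) v)
        - lam * inner ℝ θ v) 0 := by
    unfold LogisticBandit.logLik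
    refine HasDerivAt.sub (HasDerivAt.fun_sum fun s _ => ?_) hnorm
    have e : inner ℝ (x s) (θ + (0 : ℝ) • v) = inner ℝ (x s) θ := by simp
    have h1 := (hasDerivAt_log_sigmoid (inner ℝ (x s) (θ + (0 : ℝ) • v))).comp (0 : ℝ) (hlin s)
    have h2 := (hasDerivAt_log_one_sub_sigmoid
      (inner ℝ (x s) (θ + (0 : ℝ) • v))).comp (0 : ℝ) (hlin s)
    have h := (h1.const_mul (r (s + 1))).add (h2.const_mul (1 - r (s + 1)))
    rw [e] at h
    exact h.congr_deriv (by ring)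
  have hloc : IsLocalMax (fun u : ℝ => LogisticBandit.logLik lam x r t (θ + u • v)) 0 := by
    refine Filter.Eventually.of_forall fun u => ?_
    simpa using hmax (Set.mem_univ (θ + u • v))
  have h0 := hloc.hasDerivAt_eq_zero hder
  simp only [LogisticBandit.g, inner_add_left, sum_inner, inner_smul_left, conj_trivial]
  simp only [sub_mul, Finset.sum_sub_distrib] at h0
  linarith

/-! ### Maximal inequality and conditional probabilities -/

/-- Ville's maximal inequality over the whole time axis. The supermartingale inequality is needed
only on the events that the level `c` has not yet been exceeded. -/
theorem measure_exists_lt_le {Ω : Type*} [MeasurableSpace Ω] {P : Measure Ω}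
    [IsProbabilityMeasure P] {f : ℕ → Ω → ℝ≥0∞} (hf : ∀ n, Measurable (f n)) {c K : ℝ≥0∞}
    (h0 : ∫⁻ ω, f 0 ω ∂P ≤ K)
    (hstep : ∀ n, ∫⁻ ω in {ω | ∀ k ≤ n, f k ω ≤ c}, f (n + 1) ω ∂P
      ≤ ∫⁻ ω in {ω | ∀ k ≤ n, f k ω ≤ c}, f n ω ∂P) :
    c * P {ω | ∃ n, c < f n ω} ≤ K := by
  set A : ℕ → Set Ω := fun n => {ω | ∀ k ≤ n, f k ω ≤ c} with hA
  have hAm : ∀ n, MeasurableSet (A n) := fun n => by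
    have : A n = ⋂ k, ⋂ _ : k ≤ n, {ω | f k ω ≤ c} := by ext; simp [hA]
    rw [this]
    exact MeasurableSet.iInter fun k => MeasurableSet.iInter fun _ =>
      measurableSet_le (hf k) measurable_const
  have hBm : ∀ n, MeasurableSet {ω | c < f n ω} := fun n =>
    measurableSet_lt measurable_const (hf n)
  have markov : ∀ (n : ℕ) (s : Set Ω), MeasurableSet s → s ⊆ {ω | c < f n ω} →
      c * P s ≤ ∫⁻ ω in s, f n ω ∂P := fun n s hs hsub => by
    rw [← setLIntegral_const]
    exact setLIntegral_mono' hs fun ω hω => (hsub hω).le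
  -- The potential `∫_{A n} f n + c P((A n)ᶜ)` is the mean of `f` stopped at the first exceedance of
  -- `c`, with the stopped value truncated to `c`; it does not increase with `n`.
  have main : ∀ n, ∫⁻ ω in A n, f n ω ∂P + c * P (A n)ᶜ ≤ K := by
    intro n
    induction n with
    | zero =>
      have h : (A 0)ᶜ ⊆ {ω | c < f 0 ω} := fun ω hω => by
        simpa [hA] using hω
      calc _ ≤ ∫⁻ ω in A 0, f 0 ω ∂P + ∫⁻ ω in (A 0)ᶜ, f 0 ω ∂P := by
            gcongr; exact markov 0 _ (hAm 0).compl h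
        _ = ∫⁻ ω, f 0 ω ∂P := lintegral_add_compl _ (hAm 0)
        _ ≤ K := h0
    | succ n ih =>
      have hAs : A (n + 1) = A n \ {ω | c < f (n + 1) ω} := by
        ext ω
        simp only [hA, Set.mem_ofPred_eq, Set.mem_sdiff, not_lt]
        refine ⟨fun h => ⟨fun k hk => h k (by omega), h _ le_rfl⟩, fun h k hk => ?_⟩
        rcases Nat.le_succ_iff.1 hk with hk | rfl
        exacts [h.1 k hk, h.2]
      have hc : (A (n + 1))ᶜ ⊆ (A n ∩ {ω | c < f (n + 1) ω}) ∪ (A n)ᶜ := by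
        rw [hAs]; intro ω hω
        by_cases h : ω ∈ A n
        · exact Or.inl ⟨h, by simpa [h] using hω⟩
        · exact Or.inr h
      calc _ ≤ ∫⁻ ω in A n \ {ω | c < f (n + 1) ω}, f (n + 1) ω ∂P
            + c * (P (A n ∩ {ω | c < f (n + 1) ω}) + P (A n)ᶜ) := by
            rw [← hAs]; gcongr; exact (measure_mono hc).trans (measure_union_le _ _)
        _ ≤ ∫⁻ ω in A n \ {ω | c < f (n + 1) ω}, f (n + 1) ω ∂P
            + (∫⁻ ω in A n ∩ {ω | c < f (n + 1) ω}, f (n + 1) ω ∂P + c * P (A n)ᶜ) := by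
            rw [mul_add]; gcongr
            exact markov _ _ ((hAm n).inter (hBm _)) Set.inter_subset_right
        _ = ∫⁻ ω in A n, f (n + 1) ω ∂P + c * P (A n)ᶜ := by
            rw [← add_assoc, add_comm (∫⁻ ω in A n \ _, _ ∂P),
              lintegral_inter_add_sdiff _ _ (hBm _)]
        _ ≤ ∫⁻ ω in A n, f n ω ∂P + c * P (A n)ᶜ := add_le_add_left (hstep n) _
        _ ≤ K := ih
  have hU : {ω | ∃ n, c < f n ω} = ⋃ n, (A n)ᶜ := by
    ext ω
    simp only [hA, Set.mem_ofPred_eq, Set.mem_iUnion, Set.mem_compl_iff, not_forall, not_le]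
    exact ⟨fun ⟨n, h⟩ => ⟨n, n, le_rfl, h⟩, fun ⟨n, k, _, h⟩ => ⟨k, h⟩⟩
  have hmono : Monotone fun n => (A n)ᶜ := fun m n hmn =>
    Set.compl_subset_compl.2 fun ω hω k hk => hω k (hk.trans hmn)
  rw [hU, hmono.measure_iUnion, ENNReal.mul_iSup]
  exact iSup_le fun n => le_add_self.trans (main n)

/-- Integrating an `m`-measurable nonnegative function over an event amounts to weighting it by the
conditional probability of the event given `m`. No integrability is required. -/
theorem setLIntegral_eq_lintegral_mul_condProb {Ω : Type*} {m mΩ : MeasurableSpace Ω}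
    {P : Measure Ω} [IsProbabilityMeasure P] (hm : m ≤ mΩ) {B : Set Ω} (hB : MeasurableSet B)
    {q : Ω → ℝ} (hqm : Measurable[m] q) (hq0 : ∀ ω, 0 ≤ q ω) (hq : P⟦B | m⟧ =ᵐ[P] q)
    {W : Ω → ℝ≥0∞} (hW : Measurable[m] W) :
    ∫⁻ ω in B, W ω ∂P = ∫⁻ ω, W ω * ENNReal.ofReal (q ω) ∂P := by
  have hqm' : Measurable[m] fun ω => ENNReal.ofReal (q ω) := hqm.ennreal_ofReal
  have hqi : Integrable q P := integrable_condExp.congr hq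
  have hmeas : (P.restrict B).trim hm
      = (P.withDensity fun ω => ENNReal.ofReal (q ω)).trim hm := by
    refine @Measure.ext _ m _ _ fun s hs => ?_
    rw [trim_measurableSet_eq hm hs, trim_measurableSet_eq hm hs, Measure.restrict_apply (hm _ hs),
      withDensity_apply _ (hm _ hs),
      ← ofReal_integral_eq_lintegral_ofReal hqi.integrableOn (ae_of_all _ hq0),
      ← setIntegral_congr_ae (hm _ hs) (hq.mono fun ω h _ => h),
      setIntegral_condExp hm ((integrable_const (1 : ℝ)).indicator hB) hs,
      integral_indicator hB, Measure.restrict_restrict hB]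
    simp [Set.inter_comm]
  calc ∫⁻ ω in B, W ω ∂P = ∫⁻ ω, W ω ∂((P.restrict B).trim hm) := (lintegral_trim hm hW).symm
    _ = ∫⁻ ω, W ω ∂(P.withDensity fun ω => ENNReal.ofReal (q ω)) := by
        rw [hmeas, lintegral_trim hm hW]
    _ = _ := by
        rw [lintegral_withDensity_eq_lintegral_mul _ (hqm'.mono hm le_rfl) (hW.mono hm le_rfl)]
        simp [mul_comm]

theorem condProb_compl {Ω : Type*} {m mΩ : MeasurableSpace Ω}
    {P : Measure Ω} [IsProbabilityMeasure P] (hm : m ≤ mΩ) {B : Set Ω} (hB : MeasurableSet B)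
    {q : Ω → ℝ} (hq : P⟦B | m⟧ =ᵐ[P] q) : P⟦Bᶜ | m⟧ =ᵐ[P] fun ω => 1 - q ω := by
  have h : Bᶜ.indicator (fun _ => (1 : ℝ)) = (fun _ => (1 : ℝ)) - B.indicator (fun _ => (1 : ℝ)) := by
    rw [Set.indicator_compl]
  rw [h]
  refine (condExp_sub (integrable_const (1 : ℝ))
    ((integrable_const (1 : ℝ)).indicator hB) m).trans ?_
  rw [condExp_const hm]
  filter_upwards [hq] with ω hω
  simp [hω]

/-! ### Gaussian integrals over balls -/

/-- Laplace-type lower bound. With `ξ₀` the point such that `T ξ₀` is the multiple of `a` of length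
`√λ / 2`, the ball of radius `1 / 2` around `ξ₀` lies in the unit ball; completing the square there
leaves a linear term, removed by symmetrization, and a Gaussian integral, which the substitution
`ζ = (√λ / 2) T⁻¹ u` compares with the isotropic one. -/
theorem le_setLIntegral_closedBall_exp_sub_sq {E : Type*} [NormedAddCommGroup E]
    [InnerProductSpace ℝ E] [FiniteDimensional ℝ E] [MeasurableSpace E] [BorelSpace E]
    {lam : ℝ} (hlam : 0 < lam) (T : E ≃ₗ[ℝ] E) (hT : ∀ v, Real.sqrt lam * ‖v‖ ≤ ‖T v‖) (a : E) :
    ENNReal.ofReal (Real.exp (Real.sqrt lam / 2 * ‖a‖ - lam / 4))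
        * ENNReal.ofReal ((Real.sqrt lam / 2) ^ Module.finrank ℝ E
            / |LinearMap.det (T : E →ₗ[ℝ] E)|)
        * ∫⁻ ξ in Metric.closedBall (0 : E) 1, ENNReal.ofReal (Real.exp (-(lam * ‖ξ‖ ^ 2)))
      ≤ ∫⁻ ξ in Metric.closedBall (0 : E) 1,
          ENNReal.ofReal (Real.exp (inner ℝ (T ξ) a - ‖T ξ‖ ^ 2)) := by
  have hsl : 0 < Real.sqrt lam := Real.sqrt_pos.2 hlam
  have hsq : Real.sqrt lam ^ 2 = lam := Real.sq_sqrt hlam.le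
  have hTc : Continuous T := T.toLinearMap.continuous_of_finiteDimensional
  set c := Real.sqrt lam / 2 with hc
  have hcpos : 0 < c := by positivity
  -- For `a = 0` the division by zero makes `b = 0`, which is the right choice.
  set b : E := (c / ‖a‖) • a with hb
  set ξ₀ : E := T.symm b with hξ₀
  have hTξ₀ : T ξ₀ = b := T.apply_symm_apply b
  have hbn : ‖b‖ ≤ c := by
    rw [hb, norm_smul, Real.norm_of_nonneg (by positivity)]
    rcases eq_or_ne ‖a‖ 0 with h | h
    · simp [h, hcpos.le]
    · rw [div_mul_cancel₀ _ h]
  have hξ₀n : ‖ξ₀‖ ≤ 1 / 2 := by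
    have := hT ξ₀
    rw [hTξ₀] at this
    have h2 : Real.sqrt lam * ‖ξ₀‖ ≤ Real.sqrt lam * (1 / 2) := by rw [hc] at hbn; linarith
    exact le_of_mul_le_mul_left h2 hsl
  have hval : c * ‖a‖ - lam / 4 ≤ inner ℝ b a - ‖b‖ ^ 2 := by
    have h1 : inner ℝ b a = c * ‖a‖ := by
      rw [hb, inner_smul_left, real_inner_self_eq_norm_sq]
      rcases eq_or_ne ‖a‖ 0 with h | h
      · simp [h]
      · simp; field_simp
    have h2 : ‖b‖ ^ 2 ≤ c ^ 2 := by gcongr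
    have h3 : c ^ 2 = lam / 4 := by rw [hc, div_pow, hsq]; norm_num
    linarith
  set ball := Metric.closedBall (0 : E) (1 / 2) with hball
  have hballm : MeasurableSet ball := Metric.isClosed_closedBall.measurableSet
  set D : ℝ := c ^ Module.finrank ℝ E / |LinearMap.det (T : E →ₗ[ℝ] E)| with hD
  -- The Gaussian integral over the small ball is compared with the isotropic one on the unit ball.
  have hgauss : ENNReal.ofReal D * ∫⁻ ξ in Metric.closedBall (0 : E) 1,
      ENNReal.ofReal (Real.exp (-(lam * ‖ξ‖ ^ 2)))
      ≤ ∫⁻ ζ in ball, ENNReal.ofReal (Real.exp (-‖T ζ‖ ^ 2)) := by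
    set R : E →ₗ[ℝ] E := c • (T.symm : E →ₗ[ℝ] E) with hR
    have hdetR : LinearMap.det R = c ^ Module.finrank ℝ E * (LinearMap.det (T : E →ₗ[ℝ] E))⁻¹ := by
      rw [hR, LinearMap.det_smul, LinearEquiv.det_coe_symm]
    have hTdet : LinearMap.det (T : E →ₗ[ℝ] E) ≠ 0 := T.isUnit_det'.ne_zero
    have hR0 : LinearMap.det R ≠ 0 := by rw [hdetR]; positivity
    have hDabs : D = |LinearMap.det R| := by
      rw [hdetR, abs_mul, abs_inv, abs_of_pos (pow_pos hcpos _), hD, div_eq_mul_inv]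
    have hRm : Measurable R := R.continuous_of_finiteDimensional.measurable
    have hvol : (volume : Measure E)
        = ENNReal.ofReal D • Measure.map R volume := by
      rw [Measure.map_linearMap_addHaar_eq_smul_addHaar volume hR0, smul_smul, hDabs,
        ← ENNReal.ofReal_mul (abs_nonneg _), abs_inv, mul_inv_cancel₀ (abs_ne_zero.2 hR0)]
      simp
    have hTm : Measurable fun ζ => ENNReal.ofReal (Real.exp (-‖T ζ‖ ^ 2)) := by
      have := hTc.measurable
      fun_prop
    rw [← lintegral_indicator hballm, ← lintegral_indicator Metric.isClosed_closedBall.measurableSet]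
    conv_rhs => rw [hvol]
    rw [lintegral_smul_measure, lintegral_map (hTm.indicator hballm) hRm, smul_eq_mul]
    gcongr with u
    by_cases hu : u ∈ Metric.closedBall (0 : E) 1
    swap
    · rw [Set.indicator_of_notMem hu]
      exact zero_le
    rw [Set.indicator_of_mem hu]
    have hTR : T (R u) = c • u := by simp [hR]
    have hu1 : ‖u‖ ≤ 1 := by simpa using hu
    have hnTR : ‖T (R u)‖ = c * ‖u‖ := by rw [hTR, norm_smul, Real.norm_of_nonneg hcpos.le]
    have hmem : R u ∈ ball := by
      rw [hball, mem_closedBall_zero_iff]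
      have h1 := hT (R u)
      rw [hnTR] at h1
      have h2 : Real.sqrt lam * ‖R u‖ ≤ Real.sqrt lam * (1 / 2) := by
        refine h1.trans ?_
        rw [hc]
        nlinarith
      exact le_of_mul_le_mul_left h2 hsl
    rw [Set.indicator_of_mem hmem]
    refine ENNReal.ofReal_le_ofReal (Real.exp_le_exp.2 ?_)
    rw [hnTR, mul_pow, hc, div_pow, hsq]
    nlinarith [sq_nonneg ‖u‖]
  -- Averaging over `ζ` and `-ζ` turns the linear term into a hyperbolic cosine, which is at least `1`.
  set e : E := a - (2 : ℝ) • b with he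
  set G : E → ℝ≥0∞ := fun ζ => ENNReal.ofReal (Real.exp (inner ℝ (T ζ) e - ‖T ζ‖ ^ 2)) with hG
  have hGm : Measurable G := by
    have := hTc.measurable
    fun_prop
  have hsymm : ∫⁻ ζ in ball, ENNReal.ofReal (Real.exp (-‖T ζ‖ ^ 2)) ≤ ∫⁻ ζ in ball, G ζ := by
    have hneg : ∫⁻ ζ in ball, G (-ζ) = ∫⁻ ζ in ball, G ζ := by
      have := (Measure.measurePreserving_neg (volume : Measure E)).setLIntegral_comp_preimage
        hballm hGm
      rw [← this]
      congr 2
      simp [hball]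
    have h2 : 2 * ∫⁻ ζ in ball, ENNReal.ofReal (Real.exp (-‖T ζ‖ ^ 2))
        ≤ 2 * ∫⁻ ζ in ball, G ζ := by
      calc _ = ∫⁻ ζ in ball, 2 * ENNReal.ofReal (Real.exp (-‖T ζ‖ ^ 2)) := by
            rw [lintegral_const_mul' _ _ (by simp)]
        _ ≤ ∫⁻ ζ in ball, (G ζ + G (-ζ)) := by
            gcongr with ζ
            simp only [hG, map_neg, inner_neg_left, norm_neg]
            rw [← ENNReal.ofReal_add (by positivity) (by positivity),
              ← ENNReal.ofReal_ofNat 2, ← ENNReal.ofReal_mul (by norm_num)]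
            refine ENNReal.ofReal_le_ofReal ?_
            rw [sub_eq_add_neg, sub_eq_add_neg, Real.exp_add, Real.exp_add, ← add_mul]
            gcongr
            have := Real.one_le_cosh (inner ℝ (T ζ) e)
            rw [Real.cosh_eq] at this
            linarith
        _ = _ := by rw [lintegral_add_left hGm, hneg, two_mul]
    exact (ENNReal.mul_le_mul_iff_right (by simp) (by simp)).1 h2
  -- The unit ball contains the translate of the small ball by `ξ₀`.
  have htrans : ENNReal.ofReal (Real.exp (c * ‖a‖ - lam / 4)) * ∫⁻ ζ in ball, G ζ
      ≤ ∫⁻ ξ in Metric.closedBall (0 : E) 1,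
          ENNReal.ofReal (Real.exp (inner ℝ (T ξ) a - ‖T ξ‖ ^ 2)) := by
    rw [← lintegral_const_mul _ hGm, ← lintegral_indicator hballm,
      ← lintegral_indicator Metric.isClosed_closedBall.measurableSet,
      ← lintegral_add_left_eq_self (μ := volume) ((Metric.closedBall (0 : E) 1).indicator _) ξ₀]
    gcongr with ζ
    by_cases hζ : ζ ∈ ball
    swap
    · rw [Set.indicator_of_notMem hζ]
      exact zero_le
    rw [Set.indicator_of_mem hζ]
    have hζ' : ‖ζ‖ ≤ 1 / 2 := by simpa [hball] using hζ
    have hmem : ξ₀ + ζ ∈ Metric.closedBall (0 : E) 1 := by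
      rw [mem_closedBall_zero_iff]
      linarith [norm_add_le ξ₀ ζ]
    rw [Set.indicator_of_mem hmem, hG, ← ENNReal.ofReal_mul (by positivity), ← Real.exp_add]
    refine ENNReal.ofReal_le_ofReal (Real.exp_le_exp.2 ?_)
    rw [map_add, hTξ₀, norm_add_sq_real, inner_add_left, he, inner_sub_right, inner_smul_right,
      real_inner_comm b (T ζ)]
    linarith
  calc _ = ENNReal.ofReal (Real.exp (c * ‖a‖ - lam / 4)) * (ENNReal.ofReal D
        * ∫⁻ ξ in Metric.closedBall (0 : E) 1, ENNReal.ofReal (Real.exp (-(lam * ‖ξ‖ ^ 2)))) := by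
        rw [mul_assoc]
    _ ≤ _ := (mul_le_mul_right (hgauss.trans hsymm) _).trans htrans

/-! ### Quadratic forms and determinants -/

open scoped MatrixOrder in
/-- A symmetric matrix `M ≥ λ I` is `Tᵀ T` for an invertible `T`. With `A = T M⁻¹ = (Tᵀ)⁻¹`, the
weighted norm `‖s‖_{M⁻¹}` is `‖A s‖`, and `⟪ξ, s⟫ = ⟪T ξ, A s⟫`. -/
theorem exists_linearEquiv_norm_sq_eq {d : ℕ} {lam : ℝ} (hlam : 0 < lam)
    {M : Matrix (Fin d) (Fin d) ℝ} (hM : M.IsHermitian)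
    (hle : ∀ v : EuclideanSpace ℝ (Fin d), lam * ‖v‖ ^ 2 ≤ v.ofLp ⬝ᵥ M.mulVec v.ofLp) :
    ∃ (T : EuclideanSpace ℝ (Fin d) ≃ₗ[ℝ] EuclideanSpace ℝ (Fin d))
      (A : EuclideanSpace ℝ (Fin d) →ₗ[ℝ] EuclideanSpace ℝ (Fin d)),
      (∀ v, ‖T v‖ ^ 2 = v.ofLp ⬝ᵥ M.mulVec v.ofLp) ∧
      (∀ v, Real.sqrt lam * ‖v‖ ≤ ‖T v‖) ∧
      |LinearMap.det (T : EuclideanSpace ℝ (Fin d) →ₗ[ℝ] EuclideanSpace ℝ (Fin d))|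
        = Real.sqrt M.det ∧
      (∀ s ξ, inner ℝ (T ξ) (A s) = inner ℝ ξ s) ∧
      (∀ s, LogisticBandit.wnorm M⁻¹ s = ‖A s‖) := by
  have hpos : M.PosDef := by
    refine Matrix.PosDef.of_dotProduct_mulVec_pos hM fun v hv => ?_
    have h := hle (WithLp.toLp 2 v)
    have h0 : 0 < ‖WithLp.toLp 2 v‖ := by simpa using hv
    rw [star_trivial]
    exact lt_of_lt_of_le (by positivity) h
  obtain ⟨B, hB⟩ := CStarAlgebra.nonneg_iff_eq_star_mul_self.mp hpos.posSemidef.nonneg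
  have hBt : M = B.transpose * B := by
    rw [hB, Matrix.star_eq_conjTranspose, Matrix.conjTranspose_eq_transpose_of_trivial]
  have hof : ∀ (N : Matrix (Fin d) (Fin d) ℝ) (v : EuclideanSpace ℝ (Fin d)),
      (Matrix.toLpLin 2 2 N v).ofLp = N.mulVec v.ofLp := fun _ _ => rfl
  set T₀ := Matrix.toLpLin 2 2 B with hT₀
  have hinner : ∀ v w, inner ℝ (T₀ v) (T₀ w) = v.ofLp ⬝ᵥ M.mulVec w.ofLp := fun v w => by
    rw [EuclideanSpace.inner_eq_star_dotProduct, star_trivial, hof,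
      hof, hBt, ← Matrix.mulVec_mulVec, dotProduct_comm,
      Matrix.dotProduct_mulVec _ B.transpose, Matrix.vecMul_transpose]
  have hnorm : ∀ v, ‖T₀ v‖ ^ 2 = v.ofLp ⬝ᵥ M.mulVec v.ofLp := fun v => by
    rw [← hinner, real_inner_self_eq_norm_sq]
  have hge : ∀ v, Real.sqrt lam * ‖v‖ ≤ ‖T₀ v‖ := fun v => by
    refine le_of_sq_le_sq ?_ (norm_nonneg _)
    rw [mul_pow, Real.sq_sqrt hlam.le, hnorm]
    exact hle v
  have hinj : Function.Injective T₀ := by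
    refine (injective_iff_map_eq_zero T₀).2 fun v hv => ?_
    have h := hge v
    rw [hv, norm_zero] at h
    have := Real.sqrt_pos.2 hlam
    exact norm_eq_zero.1 (le_antisymm (by nlinarith) (norm_nonneg v))
  have hMdet : IsUnit M.det := hpos.det_pos.ne'.isUnit
  have hcancel : ∀ s : EuclideanSpace ℝ (Fin d),
      M.mulVec (Matrix.toLpLin 2 2 M⁻¹ s).ofLp = s.ofLp := fun s => by
    rw [hof, Matrix.mulVec_mulVec, Matrix.mul_nonsing_inv _ hMdet,
      Matrix.one_mulVec]
  refine ⟨LinearEquiv.ofInjectiveEndo T₀ hinj, T₀ ∘ₗ Matrix.toLpLin 2 2 M⁻¹, hnorm, hge,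
    ?_, fun s ξ => ?_, fun s => ?_⟩
  · have h1 : ((LinearEquiv.ofInjectiveEndo T₀ hinj : _ ≃ₗ[ℝ] _) :
        EuclideanSpace ℝ (Fin d) →ₗ[ℝ] EuclideanSpace ℝ (Fin d)) = T₀ := rfl
    rw [h1, hT₀, Matrix.toLpLin_eq_toLin, LinearMap.det_toLin, hBt, Matrix.det_mul,
      Matrix.det_transpose, Real.sqrt_mul_self_eq_abs]
  · change inner ℝ (T₀ ξ) (T₀ (Matrix.toLpLin 2 2 M⁻¹ s)) = _
    rw [hinner, hcancel, EuclideanSpace.inner_eq_star_dotProduct, star_trivial, dotProduct_comm]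
  · have h1 : ‖T₀ (Matrix.toLpLin 2 2 M⁻¹ s)‖ ^ 2 = s.ofLp ⬝ᵥ M⁻¹.mulVec s.ofLp := by
      rw [hnorm, hcancel, hof, dotProduct_comm]
    rw [LogisticBandit.wnorm, ← h1, Real.sqrt_sq (norm_nonneg _)]
    rfl

/-- The inequality of arithmetic and geometric means for the eigenvalues of a matrix. -/
theorem det_le_trace_div_pow {d : ℕ} (hd : 1 ≤ d) {M : Matrix (Fin d) (Fin d) ℝ}
    (hM : M.PosSemidef) : M.det ≤ (M.trace / d) ^ d := by
  have h := Real.geom_mean_le_arith_mean (Finset.univ : Finset (Fin d)) (fun _ => 1)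
    hM.1.eigenvalues (fun _ _ => zero_le_one) (by simpa using Nat.lt_of_lt_of_le one_pos hd) fun i _ => hM.eigenvalues_nonneg i
  have hdet : M.det = ∏ i, hM.1.eigenvalues i := by
    simpa using hM.1.det_eq_prod_eigenvalues
  have htr : M.trace = ∑ i, hM.1.eigenvalues i := by
    simpa using hM.1.trace_eq_sum_eigenvalues
  simp only [Real.rpow_one, one_mul, Finset.sum_const, Finset.card_univ, Fintype.card_fin,
    nsmul_eq_mul, mul_one] at h
  rw [← hdet, ← htr] at h
  have h0 : 0 ≤ M.det := hM.det_nonneg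
  calc M.det = (M.det ^ ((d : ℝ)⁻¹)) ^ d := by
        rw [Real.rpow_inv_natCast_pow h0 (by omega)]
    _ ≤ _ := by gcongr

/-! ### The exponential supermartingale -/

/-- The exponential process `exp (⟪ξ, S_t⟫ - ξᵀ (H_t(θ) - λ I) ξ)`, where
`S_t = ∑_{1 ≤ s < t} (r_{s+1} - μ(x_sᵀθ)) x_s` is the noise and `μ (1 - μ)` stands for the derivative
of the sigmoid `μ`. It takes values in `ℝ≥0∞` so that its integrals always make sense. -/
noncomputable def tiltedLik {d : ℕ} (θ : EuclideanSpace ℝ (Fin d))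
    (x : ℕ → EuclideanSpace ℝ (Fin d)) (r : ℕ → ℝ) (t : ℕ) (ξ : EuclideanSpace ℝ (Fin d)) : ℝ≥0∞ :=
  ENNReal.ofReal (Real.exp (∑ s ∈ Finset.Ico 1 t,
    (inner ℝ (x s) ξ * (r (s + 1) - Real.sigmoid (inner ℝ (x s) θ))
      - Real.sigmoid (inner ℝ (x s) θ) * (1 - Real.sigmoid (inner ℝ (x s) θ))
        * inner ℝ (x s) ξ ^ 2)))

theorem tiltedLik_succ {d : ℕ} (θ : EuclideanSpace ℝ (Fin d))
    (x : ℕ → EuclideanSpace ℝ (Fin d)) (r : ℕ → ℝ) {t : ℕ} (ht : 1 ≤ t)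
    (ξ : EuclideanSpace ℝ (Fin d)) :
    tiltedLik θ x r (t + 1) ξ = tiltedLik θ x r t ξ * ENNReal.ofReal (Real.exp
      (inner ℝ (x t) ξ * (r (t + 1) - Real.sigmoid (inner ℝ (x t) θ))
      - Real.sigmoid (inner ℝ (x t) θ) * (1 - Real.sigmoid (inner ℝ (x t) θ))
        * inner ℝ (x t) ξ ^ 2)) := by
  rw [tiltedLik, tiltedLik, Finset.sum_Ico_succ_top ht, Real.exp_add,
    ENNReal.ofReal_mul (Real.exp_nonneg _)]

theorem measurable_uncurry_tiltedLik {Ω : Type*} {m : MeasurableSpace Ω} {d : ℕ}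
    (θ : EuclideanSpace ℝ (Fin d)) {x : ℕ → Ω → EuclideanSpace ℝ (Fin d)} {r : ℕ → Ω → ℝ} {t : ℕ}
    (hx : ∀ s ∈ Finset.Ico 1 t, Measurable (x s))
    (hr : ∀ s ∈ Finset.Ico 1 t, Measurable (r (s + 1))) :
    Measurable (Function.uncurry fun ω ξ => tiltedLik θ (fun s => x s ω) (fun s => r s ω) t ξ) := by
  refine ENNReal.measurable_ofReal.comp (Real.measurable_exp.comp
    (Finset.measurable_sum _ fun s hs => ?_))
  have h1 : Measurable fun p : Ω × EuclideanSpace ℝ (Fin d) => x s p.1 :=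
    (hx s hs).comp measurable_fst
  have h2 : Measurable fun p : Ω × EuclideanSpace ℝ (Fin d) => r (s + 1) p.1 :=
    (hr s hs).comp measurable_fst
  have h3 : Measurable fun p : Ω × EuclideanSpace ℝ (Fin d) =>
      (inner ℝ (x s p.1) p.2 : ℝ) := h1.inner measurable_snd
  have h4 : Measurable fun p : Ω × EuclideanSpace ℝ (Fin d) =>
      Real.sigmoid (inner ℝ (x s p.1) θ) :=
    continuous_sigmoid.measurable.comp (h1.inner measurable_const)
  exact (h3.mul (h2.sub h4)).sub ((h4.mul (measurable_const.sub h4)).mul (h3.pow_const 2))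

theorem measurable_tiltedLik {Ω : Type*} {m : MeasurableSpace Ω} {d : ℕ}
    (θ : EuclideanSpace ℝ (Fin d)) {x : ℕ → Ω → EuclideanSpace ℝ (Fin d)} {r : ℕ → Ω → ℝ} {t : ℕ}
    (hx : ∀ s ∈ Finset.Ico 1 t, Measurable (x s))
    (hr : ∀ s ∈ Finset.Ico 1 t, Measurable (r (s + 1))) (ξ : EuclideanSpace ℝ (Fin d)) :
    Measurable fun ω => tiltedLik θ (fun s => x s ω) (fun s => r s ω) t ξ :=
  (measurable_uncurry_tiltedLik θ hx hr).of_uncurry_right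

theorem measurableSet_forall_lintegral_tiltedLik_le {Ω : Type*} {m : MeasurableSpace Ω} {d : ℕ}
    (θ : EuclideanSpace ℝ (Fin d)) {x : ℕ → Ω → EuclideanSpace ℝ (Fin d)} {r : ℕ → Ω → ℝ} {n : ℕ}
    (hx : ∀ s ∈ Finset.Ico 1 (n + 1), Measurable (x s))
    (hr : ∀ s ∈ Finset.Ico 1 (n + 1), Measurable (r (s + 1)))
    (ν : Measure (EuclideanSpace ℝ (Fin d))) [SFinite ν] (c : ℝ≥0∞) :
    MeasurableSet {ω | ∀ k ≤ n,
      ∫⁻ ξ, tiltedLik θ (fun s => x s ω) (fun s => r s ω) (k + 1) ξ ∂ν ≤ c} := by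
  have hset : {ω | ∀ k ≤ n, ∫⁻ ξ, tiltedLik θ (fun s => x s ω) (fun s => r s ω) (k + 1) ξ ∂ν ≤ c}
      = ⋂ k, ⋂ _ : k ≤ n,
        {ω | ∫⁻ ξ, tiltedLik θ (fun s => x s ω) (fun s => r s ω) (k + 1) ξ ∂ν ≤ c} := by
    ext; simp
  rw [hset]
  refine MeasurableSet.iInter fun k => MeasurableSet.iInter fun hk => ?_
  have hk' : ∀ s ∈ Finset.Ico 1 (k + 1), s ∈ Finset.Ico 1 (n + 1) := fun s hs => by
    simp only [Finset.mem_Ico] at hs ⊢; omega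
  exact measurableSet_le (measurable_uncurry_tiltedLik θ (fun s hs => hx s (hk' s hs))
    (fun s hs => hr s (hk' s hs))).lintegral_prod_right measurable_const

theorem history_le_historyWithAction {Ω : Type*} {d : ℕ} (F0 : MeasurableSpace Ω)
    (x : ℕ → Ω → EuclideanSpace ℝ (Fin d)) (r : ℕ → Ω → ℝ) (t : ℕ) :
    LogisticBandit.history F0 x r t ≤ LogisticBandit.historyWithAction F0 x r t := le_sup_right

theorem measurable_history {Ω : Type*} {d : ℕ} (F0 : MeasurableSpace Ω)
    (x : ℕ → Ω → EuclideanSpace ℝ (Fin d)) (r : ℕ → Ω → ℝ) {s t : ℕ} (hs : s ∈ Finset.Ico 1 t) :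
    Measurable[LogisticBandit.history F0 x r t] (x s) ∧
      Measurable[LogisticBandit.history F0 x r t] (r (s + 1)) := by
  have h : MeasurableSpace.comap (x s) inferInstance ⊔ MeasurableSpace.comap (r (s + 1)) inferInstance
      ≤ LogisticBandit.history F0 x r t :=
    le_sup_of_le_right (le_iSup₂_of_le (f := fun s (_ : s ∈ Finset.Ico 1 t) =>
      MeasurableSpace.comap (x s) inferInstance ⊔ MeasurableSpace.comap (r (s + 1)) inferInstance)
      s hs le_rfl)
  exact ⟨measurable_iff_comap_le.2 (le_sup_left.trans h),
    measurable_iff_comap_le.2 (le_sup_right.trans h)⟩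

/-- For `‖ξ‖ ≤ 1`, `tiltedLik` is a supermartingale: its integral over an event known before the
reward of round `t` is drawn does not increase from `t` to `t + 1`. -/
theorem setLIntegral_tiltedLik_succ_le {Ω : Type*} {m mΩ : MeasurableSpace Ω} {P : Measure Ω}
    [IsProbabilityMeasure P] (hm : m ≤ mΩ) {d : ℕ} (θ : EuclideanSpace ℝ (Fin d))
    {x : ℕ → Ω → EuclideanSpace ℝ (Fin d)} {r : ℕ → Ω → ℝ} {t : ℕ} (ht : 1 ≤ t)
    (hx : ∀ s ∈ Finset.Icc 1 t, Measurable[m] (x s))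
    (hr : ∀ s ∈ Finset.Ico 1 t, Measurable[m] (r (s + 1)))
    (hrt : Measurable (r (t + 1))) (hbin : ∀ ω, r (t + 1) ω = 0 ∨ r (t + 1) ω = 1)
    (hxt : ∀ ω, ‖x t ω‖ ≤ 1)
    (hmodel : P⟦(r (t + 1)) ⁻¹' {1} | m⟧ =ᵐ[P] fun ω => Real.sigmoid (inner ℝ (x t ω) θ))
    {ξ : EuclideanSpace ℝ (Fin d)} (hξ : ‖ξ‖ ≤ 1) {A : Set Ω} (hA : MeasurableSet[m] A) :
    ∫⁻ ω in A, tiltedLik θ (fun s => x s ω) (fun s => r s ω) (t + 1) ξ ∂P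
      ≤ ∫⁻ ω in A, tiltedLik θ (fun s => x s ω) (fun s => r s ω) t ξ ∂P := by
  set B := (r (t + 1)) ⁻¹' {1} with hB
  have hBm : MeasurableSet B := hrt (measurableSet_singleton 1)
  set p : Ω → ℝ := fun ω => Real.sigmoid (inner ℝ (x t ω) θ) with hp
  set η : Ω → ℝ := fun ω => inner ℝ (x t ω) ξ with hη
  have hxm : Measurable[m] (x t) := hx t (Finset.mem_Icc.2 ⟨ht, le_rfl⟩)
  have hpm : Measurable[m] p := continuous_sigmoid.measurable.comp (hxm.inner measurable_const)
  have hηm : Measurable[m] η := hxm.inner measurable_const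
  set V : Ω → ℝ≥0∞ := A.indicator fun ω =>
    tiltedLik θ (fun s => x s ω) (fun s => r s ω) t ξ with hV
  have hVm : Measurable[m] V := by
    refine Measurable.indicator ?_ hA
    exact measurable_tiltedLik θ (fun s hs => hx s (Finset.Ico_subset_Icc_self hs)) hr ξ
  -- `φ y` is the factor contributed by round `t` when its reward equals `y`.
  set φ : ℝ → Ω → ℝ := fun y ω => Real.exp (η ω * (y - p ω) - p ω * (1 - p ω) * η ω ^ 2) with hφ
  have hφm : ∀ y, Measurable[m] fun ω => ENNReal.ofReal (φ y ω) := fun y =>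
    (Real.measurable_exp.comp ((hηm.mul (measurable_const.sub hpm)).sub
      ((hpm.mul (measurable_const.sub hpm)).mul (hηm.pow_const 2)))).ennreal_ofReal
  have hp0 : ∀ ω, 0 ≤ p ω := fun ω => Real.sigmoid_nonneg _
  have hp1 : ∀ ω, p ω ≤ 1 := fun ω => Real.sigmoid_le_one _
  have hW : ∀ y, Measurable[m] fun ω => V ω * ENNReal.ofReal (φ y ω) := fun y => hVm.mul (hφm y)
  have hone : ∀ ω, φ 1 ω * p ω + φ 0 ω * (1 - p ω) ≤ 1 := fun ω => by
    have h1 : |η ω| ≤ 1 := (abs_real_inner_le_norm _ _).trans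
      (mul_le_one₀ (hxt ω) (norm_nonneg _) hξ)
    have h2 := bernoulli_mgf_le (hp0 ω) (hp1 ω) h1
    have h3 : φ 1 ω * p ω + φ 0 ω * (1 - p ω) = (p ω * Real.exp (η ω * (1 - p ω))
        + (1 - p ω) * Real.exp (η ω * (0 - p ω))) / Real.exp (p ω * (1 - p ω) * η ω ^ 2) := by
      simp only [hφ, Real.exp_sub]; ring
    rw [h3]
    exact div_le_one_of_le₀ h2 (Real.exp_nonneg _)
  calc ∫⁻ ω in A, tiltedLik θ (fun s => x s ω) (fun s => r s ω) (t + 1) ξ ∂P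
      = ∫⁻ ω, V ω * ENNReal.ofReal (φ (r (t + 1) ω) ω) ∂P := by
        rw [← lintegral_indicator (hm _ hA)]
        refine lintegral_congr fun ω => ?_
        by_cases h : ω ∈ A
        · simp only [hV, Set.indicator_of_mem h, tiltedLik_succ _ _ _ ht, hφ, hη, hp]
        · simp [hV, h]
    _ = ∫⁻ ω in B, V ω * ENNReal.ofReal (φ 1 ω) ∂P
        + ∫⁻ ω in Bᶜ, V ω * ENNReal.ofReal (φ 0 ω) ∂P := by
        rw [← lintegral_add_compl _ hBm]
        congr 1
        · refine setLIntegral_congr_fun hBm fun ω hω => ?_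
          have : r (t + 1) ω = 1 := hω
          simp only [this]
        · refine setLIntegral_congr_fun hBm.compl fun ω hω => ?_
          have : r (t + 1) ω = 0 := (hbin ω).resolve_right hω
          simp only [this]
    _ = ∫⁻ ω, V ω * ENNReal.ofReal (φ 1 ω) * ENNReal.ofReal (p ω) ∂P
        + ∫⁻ ω, V ω * ENNReal.ofReal (φ 0 ω) * ENNReal.ofReal (1 - p ω) ∂P := by
        rw [setLIntegral_eq_lintegral_mul_condProb hm hBm hpm hp0 hmodel (hW 1),
          setLIntegral_eq_lintegral_mul_condProb hm hBm.compl (measurable_const.sub hpm)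
            (fun ω => sub_nonneg.2 (hp1 ω)) (condProb_compl hm hBm hmodel) (hW 0)]
        rfl
    _ = ∫⁻ ω, V ω * ENNReal.ofReal (φ 1 ω * p ω + φ 0 ω * (1 - p ω)) ∂P := by
        have hm1 : Measurable[m] fun ω => V ω * ENNReal.ofReal (φ 1 ω) * ENNReal.ofReal (p ω) :=
          (hW 1).mul hpm.ennreal_ofReal
        rw [← lintegral_add_left (hm1.mono hm le_rfl)]
        refine lintegral_congr fun ω => ?_
        rw [ENNReal.ofReal_add (mul_nonneg (Real.exp_nonneg _) (hp0 ω))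
          (mul_nonneg (Real.exp_nonneg _) (sub_nonneg.2 (hp1 ω))),
          ENNReal.ofReal_mul (Real.exp_nonneg _), ENNReal.ofReal_mul (Real.exp_nonneg _)]
        ring
    _ ≤ ∫⁻ ω, V ω ∂P := by
        refine lintegral_mono fun ω => ?_
        have := ENNReal.ofReal_le_ofReal (hone ω)
        rw [ENNReal.ofReal_one] at this
        exact mul_le_of_le_one_right' this
    _ = _ := lintegral_indicator (hm _ hA) _

/-- Ville's inequality for a mixture of the exponential processes over the unit ball. -/
theorem measure_exists_mixture_gt_le {Ω : Type*} (F0 : MeasurableSpace Ω) [mΩ : MeasurableSpace Ω]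
    (P : Measure Ω) [IsProbabilityMeasure P] {d : ℕ} (θ : EuclideanSpace ℝ (Fin d))
    {x : ℕ → Ω → EuclideanSpace ℝ (Fin d)} (hx_meas : ∀ t, 1 ≤ t → Measurable[mΩ] (x t))
    (hx : ∀ t, 1 ≤ t → ∀ ω, ‖x t ω‖ ≤ 1)
    {r : ℕ → Ω → ℝ} (hr_meas : ∀ t, 1 ≤ t → Measurable[mΩ] (r (t + 1)))
    (hr_bin : ∀ t, 1 ≤ t → ∀ ω, r (t + 1) ω = 0 ∨ r (t + 1) ω = 1)
    (hF0 : F0 ≤ mΩ)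
    (hmodel : ∀ t, 1 ≤ t →
      P⟦(r (t + 1)) ⁻¹' {1} | LogisticBandit.historyWithAction F0 x r t⟧
        =ᵐ[P] fun ω => Real.sigmoid (inner ℝ (x t ω) θ))
    (ν : Measure (EuclideanSpace ℝ (Fin d))) [SFinite ν] (hν : ∀ᵐ ξ ∂ν, ‖ξ‖ ≤ 1) (c : ℝ≥0∞) :
    c * P {ω | ∃ n, c < ∫⁻ ξ, tiltedLik θ (fun s => x s ω) (fun s => r s ω) (n + 1) ξ ∂ν}
      ≤ ν Set.univ := by
  have hjoint : ∀ n, Measurable (Function.uncurry fun ω ξ =>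
      tiltedLik θ (fun s => x s ω) (fun s => r s ω) (n + 1) ξ) := fun n =>
    measurable_uncurry_tiltedLik θ (fun s hs => hx_meas s (Finset.mem_Ico.1 hs).1)
      (fun s hs => hr_meas s (Finset.mem_Ico.1 hs).1)
  refine measure_exists_lt_le (fun n => (hjoint n).lintegral_prod_right) ?_ fun n => ?_
  · simp [tiltedLik]
  have hmx : ∀ s ∈ Finset.Icc 1 (n + 1), Measurable[LogisticBandit.historyWithAction F0 x r (n + 1)] (x s) := fun s hs => by
    rcases (Finset.mem_Icc.1 hs).2.eq_or_lt with rfl | h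
    · exact measurable_iff_comap_le.2 le_sup_left
    · exact (measurable_history F0 x r (Finset.mem_Ico.2 ⟨(Finset.mem_Icc.1 hs).1, h⟩)).1.mono
        (history_le_historyWithAction F0 x r (n + 1)) le_rfl
  have hmr : ∀ s ∈ Finset.Ico 1 (n + 1), Measurable[LogisticBandit.historyWithAction F0 x r (n + 1)] (r (s + 1)) := fun s hs =>
    (measurable_history F0 x r hs).2.mono (history_le_historyWithAction F0 x r (n + 1)) le_rfl
  have hm : LogisticBandit.historyWithAction F0 x r (n + 1) ≤ mΩ := by
    refine sup_le (measurable_iff_comap_le.1 (hx_meas _ (by omega))) (sup_le hF0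
      (iSup₂_le fun s hs => sup_le (measurable_iff_comap_le.1 (hx_meas _ (Finset.mem_Ico.1 hs).1))
        (measurable_iff_comap_le.1 (hr_meas _ (Finset.mem_Ico.1 hs).1))))
  have hAm := measurableSet_forall_lintegral_tiltedLik_le θ
    (fun s hs => hmx s (Finset.Ico_subset_Icc_self hs)) hmr ν c
  rw [lintegral_lintegral_swap (hjoint (n + 1)).aemeasurable,
    lintegral_lintegral_swap (hjoint n).aemeasurable]
  refine lintegral_mono_ae (hν.mono fun ξ hξ => ?_)
  exact setLIntegral_tiltedLik_succ_le hm θ (by omega) hmx hmr (hr_meas _ (by omega))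
    (hr_bin _ (by omega)) (hx _ (by omega)) (hmodel _ (by omega)) hξ hAm

/-! ### The design matrix -/

theorem deriv_sigmoid_nonneg (z : ℝ) : 0 ≤ deriv Real.sigmoid z := by
  rw [Real.deriv_sigmoid]
  exact mul_nonneg (Real.sigmoid_nonneg z) (sub_nonneg.2 (Real.sigmoid_le_one z))

theorem deriv_sigmoid_le_L (z : ℝ) : deriv Real.sigmoid z ≤ LogisticBandit.L := by
  rw [Real.deriv_sigmoid, LogisticBandit.L]
  nlinarith [sq_nonneg (Real.sigmoid z - 1 / 2)]

theorem isHermitian_H {d : ℕ} (lam : ℝ) (x : ℕ → EuclideanSpace ℝ (Fin d)) (t : ℕ)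
    (θ : EuclideanSpace ℝ (Fin d)) : (LogisticBandit.H lam x t θ).IsHermitian := by
  ext i j
  simp only [LogisticBandit.H, Matrix.conjTranspose_apply, Matrix.add_apply, Matrix.sum_apply,
    Matrix.smul_apply, Matrix.vecMulVec_apply, Matrix.one_apply, star_trivial, smul_eq_mul,
    eq_comm (a := j), mul_comm ((x _).ofLp j)]

theorem dotProduct_H_mulVec {d : ℕ} (lam : ℝ) (x : ℕ → EuclideanSpace ℝ (Fin d)) (t : ℕ)
    (θ v : EuclideanSpace ℝ (Fin d)) :
    v.ofLp ⬝ᵥ (LogisticBandit.H lam x t θ).mulVec v.ofLp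
      = ∑ s ∈ Finset.Ico 1 t, deriv Real.sigmoid (inner ℝ (x s) θ) * inner ℝ (x s) v ^ 2
        + lam * ‖v‖ ^ 2 := by
  rw [LogisticBandit.H, Matrix.add_mulVec, dotProduct_add, Matrix.sum_mulVec, dotProduct_sum,
    Matrix.smul_mulVec, Matrix.one_mulVec, dotProduct_smul, smul_eq_mul]
  congr 1
  · refine Finset.sum_congr rfl fun s _ => ?_
    have h : inner ℝ (x s) v = v.ofLp ⬝ᵥ (x s).ofLp := by
      rw [EuclideanSpace.inner_eq_star_dotProduct, star_trivial]
    rw [Matrix.smul_mulVec, dotProduct_smul, Matrix.vecMulVec_mulVec, dotProduct_smul, h,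
      smul_eq_mul, MulOpposite.smul_eq_mul_unop, MulOpposite.unop_op,
      dotProduct_comm (x s).ofLp v.ofLp, sq]
  · rw [← real_inner_self_eq_norm_sq, EuclideanSpace.inner_eq_star_dotProduct, star_trivial]

theorem trace_H_le {d : ℕ} (lam : ℝ) {x : ℕ → EuclideanSpace ℝ (Fin d)} {t : ℕ}
    (hx : ∀ s ∈ Finset.Ico 1 t, ‖x s‖ ≤ 1) (θ : EuclideanSpace ℝ (Fin d)) :
    (LogisticBandit.H lam x t θ).trace ≤ LogisticBandit.L * t + d * lam := by
  rw [LogisticBandit.H, Matrix.trace_add, Matrix.trace_sum, Matrix.trace_smul, Matrix.trace_one,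
    Fintype.card_fin, smul_eq_mul, mul_comm lam]
  gcongr
  have hL : 0 ≤ LogisticBandit.L := by norm_num [LogisticBandit.L]
  calc _ ≤ ∑ s ∈ Finset.Ico 1 t, LogisticBandit.L := by
        refine Finset.sum_le_sum fun s hs => ?_
        rw [Matrix.trace_smul, Matrix.trace_vecMulVec, smul_eq_mul]
        have h1 : (x s).ofLp ⬝ᵥ (x s).ofLp = ‖x s‖ ^ 2 := by
          rw [← real_inner_self_eq_norm_sq, EuclideanSpace.inner_eq_star_dotProduct, star_trivial]
        rw [h1]
        exact (mul_le_of_le_one_right (deriv_sigmoid_nonneg _)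
          (pow_le_one₀ (norm_nonneg _) (hx s hs))).trans (deriv_sigmoid_le_L _)
    _ ≤ LogisticBandit.L * t := by
        rw [Finset.sum_const, Nat.card_Ico, nsmul_eq_mul, mul_comm]
        gcongr
        exact Nat.sub_le t 1

/-- The determinant bound `det H_t(θ) ≤ λ^d (1 + L t / (d λ))^d`, in square-root form. -/
theorem sqrt_det_H_le {d : ℕ} (hd : 1 ≤ d) {lam : ℝ} (hlam : 0 < lam)
    {x : ℕ → EuclideanSpace ℝ (Fin d)} {t : ℕ}
    (hx : ∀ s ∈ Finset.Ico 1 t, ‖x s‖ ≤ 1) (θ : EuclideanSpace ℝ (Fin d)) :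
    Real.sqrt (LogisticBandit.H lam x t θ).det
      ≤ Real.sqrt lam ^ d * (1 + LogisticBandit.L * t / (d * lam)) ^ ((d : ℝ) / 2) := by
  have hL : 0 ≤ LogisticBandit.L := by norm_num [LogisticBandit.L]
  have hd' : (0 : ℝ) < d := by exact_mod_cast hd
  have hpsd : (LogisticBandit.H lam x t θ).PosSemidef := by
    refine Matrix.PosSemidef.of_dotProduct_mulVec_nonneg (isHermitian_H lam x t θ) fun v => ?_
    have := dotProduct_H_mulVec lam x t θ (WithLp.toLp 2 v)
    rw [star_trivial]
    refine le_of_le_of_eq ?_ this.symm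
    exact add_nonneg (Finset.sum_nonneg fun s _ =>
      mul_nonneg (deriv_sigmoid_nonneg _) (sq_nonneg _)) (by positivity)
  set y := 1 + LogisticBandit.L * t / (d * lam) with hy
  have hy0 : 0 ≤ y := by positivity
  have h1 : (LogisticBandit.H lam x t θ).trace / d ≤ lam * y := by
    rw [div_le_iff₀ hd']
    refine (trace_H_le lam hx θ).trans_eq ?_
    rw [hy]; field_simp; ring
  have h0 : 0 ≤ (LogisticBandit.H lam x t θ).trace / d := div_nonneg hpsd.trace_nonneg hd'.le
  calc _ ≤ Real.sqrt ((lam * y) ^ d) :=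
        Real.sqrt_le_sqrt ((det_le_trace_div_pow hd hpsd).trans (pow_le_pow_left₀ h0 h1 d))
    _ = _ := by
        rw [mul_pow, Real.sqrt_mul (by positivity), Real.sqrt_eq_rpow (y ^ d), ← Real.rpow_natCast y,
          ← Real.rpow_mul hy0, mul_one_div]
        congr 1
        rw [Real.sqrt_eq_iff_mul_self_eq (by positivity) (by positivity), ← mul_pow,
          Real.mul_self_sqrt hlam.le]

/-! ### The mixture and the confidence set -/

/-- The isotropic Gaussian weight `exp (-λ ‖ξ‖²)` restricted to the unit ball, not normalized. -/
noncomputable def truncGaussian (d : ℕ) (lam : ℝ) : Measure (EuclideanSpace ℝ (Fin d)) :=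
  (volume.restrict (Metric.closedBall 0 1)).withDensity
    fun ξ => ENNReal.ofReal (Real.exp (-(lam * ‖ξ‖ ^ 2)))

theorem truncGaussian_univ (d : ℕ) (lam : ℝ) : truncGaussian d lam Set.univ
    = ∫⁻ ξ in Metric.closedBall (0 : EuclideanSpace ℝ (Fin d)) 1,
        ENNReal.ofReal (Real.exp (-(lam * ‖ξ‖ ^ 2))) := by
  rw [truncGaussian, withDensity_apply _ MeasurableSet.univ, Measure.restrict_univ]

theorem truncGaussian_univ_ne_zero (d : ℕ) (lam : ℝ) : truncGaussian d lam Set.univ ≠ 0 := by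
  rw [truncGaussian_univ]
  refine (setLIntegral_pos_iff (by fun_prop)).2 ?_ |>.ne'
  have : Function.support (fun ξ : EuclideanSpace ℝ (Fin d) =>
      ENNReal.ofReal (Real.exp (-(lam * ‖ξ‖ ^ 2)))) = Set.univ := by
    ext ξ; simp [Real.exp_pos]
  rw [this, Set.univ_inter]
  exact Metric.measure_closedBall_pos _ _ one_pos

theorem truncGaussian_univ_ne_top (d : ℕ) {lam : ℝ} (hlam : 0 < lam) :
    truncGaussian d lam Set.univ ≠ ∞ := by
  rw [truncGaussian_univ]
  refine (lt_of_le_of_lt (lintegral_mono (g := fun _ => 1) fun ξ => ?_) ?_).ne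
  · rw [ENNReal.ofReal_le_one, Real.exp_le_one_iff]
    have := mul_nonneg hlam.le (sq_nonneg ‖ξ‖)
    linarith
  · rw [setLIntegral_const, one_mul]
    exact measure_closedBall_lt_top

theorem ae_truncGaussian_norm_le (d : ℕ) (lam : ℝ) : ∀ᵐ ξ ∂truncGaussian d lam, ‖ξ‖ ≤ 1 := by
  refine (withDensity_absolutelyContinuous _ _).ae_le ?_
  filter_upwards [ae_restrict_mem (μ := volume)
    (Metric.isClosed_closedBall (x := (0 : EuclideanSpace ℝ (Fin d))) (ε := 1)).measurableSet]
    with ξ hξ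
  simpa using hξ

/-- The weight `exp (-λ ‖ξ‖²)` supplies the regularization `λ I` missing from `tiltedLik`, so the
mixture is an integral of `exp (⟪ξ, S_t⟫ - ξᵀ H_t(θ) ξ)`. -/
theorem lintegral_tiltedLik_truncGaussian {d : ℕ} (lam : ℝ) (x : ℕ → EuclideanSpace ℝ (Fin d))
    (r : ℕ → ℝ) (t : ℕ) (θ : EuclideanSpace ℝ (Fin d)) :
    ∫⁻ ξ, tiltedLik θ x r t ξ ∂truncGaussian d lam
      = ∫⁻ ξ in Metric.closedBall (0 : EuclideanSpace ℝ (Fin d)) 1, ENNReal.ofReal (Real.exp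
          (inner ℝ ξ (∑ s ∈ Finset.Ico 1 t, (r (s + 1) - Real.sigmoid (inner ℝ (x s) θ)) • x s)
            - ξ.ofLp ⬝ᵥ (LogisticBandit.H lam x t θ).mulVec ξ.ofLp)) := by
  have hm : Measurable (tiltedLik θ x r t) := by
    unfold tiltedLik
    fun_prop
  rw [truncGaussian, lintegral_withDensity_eq_lintegral_mul _ (by fun_prop) hm]
  refine lintegral_congr fun ξ => ?_
  rw [Pi.mul_apply, tiltedLik, ← ENNReal.ofReal_mul (Real.exp_nonneg _), ← Real.exp_add,
    dotProduct_H_mulVec, inner_sum, Finset.sum_sub_distrib, Real.deriv_sigmoid]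
  simp only [inner_smul_right, real_inner_comm ξ, mul_comm (inner ℝ ξ _ : ℝ)]
  congr 2
  ring

/-- The deterministic part of the argument: wherever the mixture stays below `1 / δ` times its
initial value, the true parameter lies in the confidence set. -/
theorem mem_confSet_of_lintegral_tiltedLik_le {d : ℕ} (hd : 1 ≤ d)
    {Θ : Set (EuclideanSpace ℝ (Fin d))} {S : ℝ} {θ : EuclideanSpace ℝ (Fin d)} (hθ : θ ∈ Θ)
    (hS : ‖θ‖ ≤ S) {lam : ℝ} (hlam : 0 < lam) {δ : ℝ} (hδ : 0 < δ)
    {x : ℕ → EuclideanSpace ℝ (Fin d)} {r : ℕ → ℝ} {t : ℕ}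
    (hx : ∀ s ∈ Finset.Ico 1 t, ‖x s‖ ≤ 1)
    (hr : ∀ s ∈ Finset.Ico 1 t, 0 ≤ r (s + 1) ∧ r (s + 1) ≤ 1)
    (hmix : ∫⁻ ξ, tiltedLik θ x r t ξ ∂truncGaussian d lam
      ≤ (ENNReal.ofReal δ)⁻¹ * truncGaussian d lam Set.univ) :
    θ ∈ LogisticBandit.confSet Θ lam S δ x r t := by
  refine ⟨hθ, ?_⟩
  have hsl : 0 < Real.sqrt lam := Real.sqrt_pos.2 hlam
  have hsq : Real.sqrt lam * Real.sqrt lam = lam := Real.mul_self_sqrt hlam.le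
  obtain ⟨T, A, hTsq, hTge, hTdet, hinner, hwnorm⟩ :=
    exists_linearEquiv_norm_sq_eq hlam (isHermitian_H lam x t θ) fun v => by
      rw [dotProduct_H_mulVec]
      exact le_add_of_nonneg_left (Finset.sum_nonneg fun s _ =>
        mul_nonneg (deriv_sigmoid_nonneg _) (sq_nonneg _))
  set D := Real.sqrt (LogisticBandit.H lam x t θ).det with hD
  set N := ∑ s ∈ Finset.Ico 1 t, (r (s + 1) - Real.sigmoid (inner ℝ (x s) θ)) • x s with hN
  set y := (1 + LogisticBandit.L * t / (d * lam)) ^ ((d : ℝ) / 2) with hy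
  have hypos : 0 < y := by
    have hL : 0 ≤ LogisticBandit.L := by norm_num [LogisticBandit.L]
    positivity
  have hDpos : 0 < D := hTdet ▸ abs_pos.2 T.isUnit_det'.ne_zero
  have hDle : D ≤ Real.sqrt lam ^ d * y := sqrt_det_H_le hd hlam hx θ
  -- `A N` carries the noise: `‖A N‖ = ‖S_t‖_{H_t⁻¹}`.
  have hnoise : ‖A N‖ ≤ Real.sqrt lam / 2 + 2 / Real.sqrt lam * Real.log (2 ^ d / δ * y) := by
    have h1 := le_setLIntegral_closedBall_exp_sub_sq hlam T hTge (A N)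
    simp only [hinner, hTsq] at h1
    rw [← lintegral_tiltedLik_truncGaussian, ← truncGaussian_univ] at h1
    have h2 := (ENNReal.mul_le_mul_iff_left (truncGaussian_univ_ne_zero d lam)
      (truncGaussian_univ_ne_top d hlam)).1 (h1.trans hmix)
    rw [← ENNReal.ofReal_inv_of_pos hδ, ← ENNReal.ofReal_mul (Real.exp_nonneg _),
      ENNReal.ofReal_le_ofReal_iff (by positivity), finrank_euclideanSpace_fin, hTdet] at h2
    have h3 : Real.exp (Real.sqrt lam / 2 * ‖A N‖ - lam / 4) ≤ 2 ^ d / δ * y := by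
      have h4 : Real.exp (Real.sqrt lam / 2 * ‖A N‖ - lam / 4) * Real.sqrt lam ^ d
          ≤ (2 ^ d / δ * y) * Real.sqrt lam ^ d := by
        rw [div_pow, mul_div_assoc', div_le_iff₀ hDpos, mul_div_assoc', div_le_iff₀ (by positivity)]
          at h2
        calc _ ≤ δ⁻¹ * D * 2 ^ d := h2
          _ ≤ δ⁻¹ * (Real.sqrt lam ^ d * y) * 2 ^ d := by gcongr
          _ = _ := by ring
      exact le_of_mul_le_mul_right h4 (by positivity)
    have h5 := (Real.le_log_iff_exp_le (by positivity)).2 h3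
    have h6 : Real.sqrt lam / 2 * ‖A N‖ ≤ Real.sqrt lam / 2
        * (Real.sqrt lam / 2 + 2 / Real.sqrt lam * Real.log (2 ^ d / δ * y)) := by
      have : Real.sqrt lam / 2 * (Real.sqrt lam / 2 + 2 / Real.sqrt lam * Real.log (2 ^ d / δ * y))
          = Real.sqrt lam * Real.sqrt lam / 4 + Real.log (2 ^ d / δ * y) := by
        field_simp; ring
      rw [this, hsq]; linarith
    exact le_of_mul_le_mul_left h6 (by positivity)
  -- `A` contracts by at least `√λ`, since `T` expands by at least `√λ`.
  have hreg : ‖A (lam • θ)‖ ≤ Real.sqrt lam * S := by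
    have h1 : ‖A θ‖ ^ 2 ≤ ‖T.symm (A θ)‖ * ‖θ‖ := by
      rw [← real_inner_self_eq_norm_sq]
      nth_rewrite 1 [← T.apply_symm_apply (A θ)]
      rw [hinner]
      exact real_inner_le_norm _ _
    have h2 := hTge (T.symm (A θ))
    rw [T.apply_symm_apply] at h2
    have h3 : Real.sqrt lam * ‖A θ‖ ≤ ‖θ‖ := by
      rcases (norm_nonneg (A θ)).eq_or_lt with h | h
      · rw [← h, mul_zero]; exact norm_nonneg _
      · refine le_of_mul_le_mul_left (a := ‖A θ‖) ?_ h
        nlinarith [mul_le_mul_of_nonneg_left h1 hsl.le,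
          mul_le_mul_of_nonneg_right h2 (norm_nonneg θ)]
    rw [map_smul, norm_smul, Real.norm_of_nonneg hlam.le]
    calc lam * ‖A θ‖ = Real.sqrt lam * (Real.sqrt lam * ‖A θ‖) := by rw [← mul_assoc, hsq]
      _ ≤ _ := mul_le_mul_of_nonneg_left (h3.trans hS) hsl.le
  have hdiff : LogisticBandit.g lam x t θ
      - LogisticBandit.g lam x t (LogisticBandit.mle lam x r t) = lam • θ - N := by
    rw [g_mle hlam x r t hr, LogisticBandit.g, hN]
    simp only [sub_smul, Finset.sum_sub_distrib]
    abel
  rw [hdiff, hwnorm, map_sub, LogisticBandit.gam, ← hy]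
  refine (norm_sub_le _ _).trans ((add_le_add hreg hnoise).trans_eq ?_)
  ring

/-! ### Measurability of the event -/

theorem Measurable.wnorm_inv {Ω : Type*} {m : MeasurableSpace Ω} {d : ℕ}
    {M : Ω → Matrix (Fin d) (Fin d) ℝ} (hM : ∀ i j, Measurable fun ω => M ω i j)
    {v : Ω → EuclideanSpace ℝ (Fin d)} (hv : Measurable v) :
    Measurable fun ω => LogisticBandit.wnorm (M ω)⁻¹ (v ω) := by
  have hMm : Measurable fun ω => (fun i j => M ω i j : Fin d → Fin d → ℝ) :=
    measurable_pi_lambda _ fun i => measurable_pi_lambda _ fun j => hM i j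
  have hinv : ∀ i j, Measurable fun ω => (M ω)⁻¹ i j := fun i j => by
    have h1 : Continuous fun N : Fin d → Fin d → ℝ => (Matrix.of N).det :=
      Continuous.matrix_det continuous_id
    have h2 : Continuous fun N : Fin d → Fin d → ℝ => (Matrix.of N).adjugate i j :=
      (Continuous.matrix_adjugate continuous_id).matrix_elem i j
    have h3 : (fun ω => (M ω)⁻¹ i j) = fun ω => (M ω).det⁻¹ * (M ω).adjugate i j := by
      funext ω
      rw [Matrix.inv_def, Matrix.smul_apply, Ring.inverse_eq_inv', smul_eq_mul]
    rw [h3]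
    exact (h1.measurable.comp hMm).inv.mul (h2.measurable.comp hMm)
  have hvi : ∀ i, Measurable fun ω => (v ω).ofLp i := fun i => by fun_prop
  unfold LogisticBandit.wnorm
  simp only [dotProduct, Matrix.mulVec]
  exact (Finset.measurable_sum _ fun i _ => (hvi i).mul
    (Finset.measurable_sum _ fun j _ => (hinv i j).mul (hvi j))).sqrt

/-- The estimator is a choice of maximizer, with no measurability of its own; `g_mle` eliminates it
from the description of the event. -/
theorem measurableSet_goodEvent {Ω : Type*} [MeasurableSpace Ω] {d : ℕ}
    {Θ : Set (EuclideanSpace ℝ (Fin d))} {θ : EuclideanSpace ℝ (Fin d)} (hθ : θ ∈ Θ)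
    {x : ℕ → Ω → EuclideanSpace ℝ (Fin d)} (hx : ∀ t, 1 ≤ t → Measurable (x t))
    {r : ℕ → Ω → ℝ} (hr : ∀ t, 1 ≤ t → Measurable (r (t + 1)))
    (hr_mem : ∀ t, 1 ≤ t → ∀ ω, 0 ≤ r (t + 1) ω ∧ r (t + 1) ω ≤ 1)
    {lam : ℝ} (hlam : 0 < lam) (S δ : ℝ) :
    MeasurableSet (LogisticBandit.goodEvent Θ lam S δ x r θ) := by
  have hE : LogisticBandit.goodEvent Θ lam S δ x r θ = ⋂ t : ℕ, ⋂ _ : 1 ≤ t,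
      {ω | LogisticBandit.wnorm (LogisticBandit.H lam (fun s => x s ω) t θ)⁻¹
        (LogisticBandit.g lam (fun s => x s ω) t θ - ∑ s ∈ Finset.Ico 1 t, r (s + 1) ω • x s ω)
          ≤ LogisticBandit.gam d lam S δ t} := by
    ext ω
    simp only [LogisticBandit.goodEvent, LogisticBandit.confSet, Set.mem_ofPred_eq, Set.mem_iInter,
      hθ, true_and]
    refine forall₂_congr fun t _ => ?_
    rw [g_mle hlam _ _ _ fun s hs => hr_mem s (Finset.mem_Ico.1 hs).1 ω]
  rw [hE]
  refine MeasurableSet.iInter fun t => MeasurableSet.iInter fun _ =>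
    measurableSet_le (Measurable.wnorm_inv (fun i j => ?_) ?_) measurable_const
  · simp only [LogisticBandit.H, Matrix.add_apply, Matrix.sum_apply, Matrix.smul_apply,
      Matrix.vecMulVec_apply, smul_eq_mul]
    refine (Finset.measurable_sum _ fun s hs => ?_).add measurable_const
    have := hx s (Finset.mem_Ico.1 hs).1
    exact ((measurable_deriv _).comp (this.inner measurable_const)).mul (by fun_prop)
  · unfold LogisticBandit.g
    refine Measurable.sub (Measurable.add (Finset.measurable_sum _ fun s hs => ?_)
      measurable_const) (Finset.measurable_sum _ fun s hs => ?_)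
    · have := hx s (Finset.mem_Ico.1 hs).1
      exact (continuous_sigmoid.measurable.comp (this.inner measurable_const)).smul this
    · exact (hr s (Finset.mem_Ico.1 hs).1).smul (hx s (Finset.mem_Ico.1 hs).1)

theorem lemma1 {Ω : Type*}
    -- `F0` is the prior knowledge, a sub-σ-algebra of the σ-algebra `mΩ` of events
    (F0 : MeasurableSpace Ω) [mΩ : MeasurableSpace Ω] (P : Measure Ω) [IsProbabilityMeasure P]
    (d : ℕ) (hd : 1 ≤ d)
    -- parameter set, its radius, and the unknown parameter
    (Θ : Set (EuclideanSpace ℝ (Fin d))) (hΘ : IsCompact Θ)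
    (S : ℝ) (hS : IsGreatest ((fun θ : EuclideanSpace ℝ (Fin d) => ‖θ‖) '' Θ) S)
    (θstar : EuclideanSpace ℝ (Fin d)) (hθstar : θstar ∈ Θ)
    -- (random) action sets inside the unit ball, and the actions played
    (X : ℕ → Ω → Set (EuclideanSpace ℝ (Fin d)))
    (hX : ∀ t, 1 ≤ t → ∀ ω, ∀ v ∈ X t ω, ‖v‖ ≤ 1)
    (x : ℕ → Ω → EuclideanSpace ℝ (Fin d))
    (hx_meas : ∀ t, 1 ≤ t → Measurable[mΩ] (x t))
    (hx_mem : ∀ t, 1 ≤ t → ∀ ω, x t ω ∈ X t ω)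
    -- binary rewards: `r (t + 1)` is the reward of round `t`
    (r : ℕ → Ω → ℝ)
    (hr_meas : ∀ t, 1 ≤ t → Measurable[mΩ] (r (t + 1)))
    (hr_bin : ∀ t, 1 ≤ t → ∀ ω, r (t + 1) ω = 0 ∨ r (t + 1) ω = 1)
    -- the logistic reward model
    (hF0 : F0 ≤ mΩ)
    (hmodel : ∀ t, 1 ≤ t →
      P⟦(r (t + 1)) ⁻¹' {1} | LogisticBandit.historyWithAction F0 x r t⟧
        =ᵐ[P] fun ω => Real.sigmoid (inner ℝ (x t ω) θstar))
    -- regularization and confidence level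
    (lam : ℝ) (hlam : 0 < lam) (δ : ℝ) (hδ0 : 0 < δ) (hδ1 : δ ≤ 1) :
    MeasurableSet[mΩ] (LogisticBandit.goodEvent Θ lam S δ x r θstar) ∧
      ENNReal.ofReal (1 - δ) ≤ P (LogisticBandit.goodEvent Θ lam S δ x r θstar) := by
  have hx_norm : ∀ t, 1 ≤ t → ∀ ω, ‖x t ω‖ ≤ 1 := fun t ht ω => hX t ht ω _ (hx_mem t ht ω)
  have hr_mem : ∀ t, 1 ≤ t → ∀ ω, 0 ≤ r (t + 1) ω ∧ r (t + 1) ω ≤ 1 := fun t ht ω => by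
    rcases hr_bin t ht ω with h | h <;> simp [h]
  have hSle : ‖θstar‖ ≤ S := hS.2 ⟨θstar, hθstar, rfl⟩
  have hmeas := measurableSet_goodEvent hθstar hx_meas hr_meas hr_mem hlam S δ
  refine ⟨hmeas, ?_⟩
  set ν := truncGaussian d lam with hν
  have hν0 := truncGaussian_univ_ne_zero d lam
  have hνtop := truncGaussian_univ_ne_top d hlam
  have : IsFiniteMeasure ν := ⟨hνtop.lt_top⟩
  set c := (ENNReal.ofReal δ)⁻¹ * ν Set.univ with hc
  have hville := measure_exists_mixture_gt_le F0 P θstar hx_meas hx_norm hr_meas hr_bin hF0 hmodel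
    ν (ae_truncGaussian_norm_le d lam) c
  set bad := {ω | ∃ n, c < ∫⁻ ξ, tiltedLik θstar (fun s => x s ω) (fun s => r s ω) (n + 1) ξ ∂ν}
    with hbad
  have hsub : (LogisticBandit.goodEvent Θ lam S δ x r θstar)ᶜ ⊆ bad := by
    refine Set.compl_subset_comm.1 fun ω hω t ht => ?_
    simp only [hbad, Set.mem_compl_iff, Set.mem_ofPred_eq, not_exists, not_lt] at hω
    -- Rounds start at `1`, the processes in the maximal inequality at `0`.
    obtain ⟨n, rfl⟩ : ∃ n, t = n + 1 := ⟨t - 1, by omega⟩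
    exact mem_confSet_of_lintegral_tiltedLik_le hd hθstar hSle hlam hδ0
      (fun s hs => hx_norm s (Finset.mem_Ico.1 hs).1 ω)
      (fun s hs => hr_mem s (Finset.mem_Ico.1 hs).1 ω) (hω n)
  have hδne : ENNReal.ofReal δ ≠ 0 := by simpa using hδ0
  have hPbad : P bad ≤ ENNReal.ofReal δ := by
    have h1 : (ENNReal.ofReal δ)⁻¹ * P bad * ν Set.univ ≤ 1 * ν Set.univ := by
      rw [one_mul]
      calc _ = c * P bad := by rw [hc]; ring
        _ ≤ _ := hville
    have h2 := (ENNReal.mul_le_mul_iff_left hν0 hνtop).1 h1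
    rwa [ENNReal.inv_mul_le_iff hδne ENNReal.ofReal_ne_top, mul_one] at h2
  have hcompl := (measure_mono hsub).trans hPbad
  rw [prob_compl_eq_one_sub hmeas] at hcompl
  rw [ENNReal.ofReal_sub _ hδ0.le, ENNReal.ofReal_one]
  exact tsub_le_iff_tsub_le.1 hcompl
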